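/- Let $\lambda\in\mathbb R$, $\sigma_v^2>0$, $\sigma_n^2\ge 0$, and let $D\ge 0$. Let $x_0=0$, $x_t=\lambda x_{t-1}+v_t$ and $y_t=x_t+n_t$ for $t\ge 1$, where $(v_t)$ and $(n_t)$ are independent sequences of i.i.d. zero-mean Gaussian variables of variances $\sigma_v^2$ and $\sigma_n^2$. Write $a^t=(a_1,\dots,a_t)$; all functions below are measurable, and information is measured in bits. Operational function. A causal code of horizon $T$ with decoder side information consists of rates $R_1,\dots,R_T$, encoders $f_t=\mathcal F_t(x^t)\in\{1,\dots,\lfloor 2^{R_t}\rfloor\}$ and decoders $\hat x_t=\mathcal G_t(f^t,y^t)\in\mathbb R$, $t=1,\dots,T$. Its average rate is $\frac1T\sum_{t=1}^T R_t$ and its average distortion is $\frac1T\sum_{t=1}^T\mathbb E[(x_t-\hat x_t)^2]$. A rate $R\ge0$ is achievable at distortion $D$ if for every sufficiently large $T$ there is such a code with average rate at most $R$ and average distortion at most $D$. Let $R^{\mathrm{dec}}_{c,op}(D)\in[0,\infty]$ be the infimum of the rates that are achievable at distortion $D$ (with $\inf\emptyset=\infty$). Information function. Let $$R^{\mathrm{dec}}_{c}(D)=\limsup_{T\to\infty}\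 \inf\ \frac1T I(x^T\to w^T)\in[0,\infty],\qquad I(x^T\to w^T)=\sum_{t=1}^T I(x^t;w_t\mid w^{t-1}),$$ where the infimum is over all causal kernels $P(w^T\|x^T)=\prod_{t=1}^T P(w_t\mid w^{t-1},x^t)$ with real-valued $w_t$ (that is, $w_t$ is drawn from $P(\cdot\mid w^{t-1},x^t)$ given $x^T,y^T,w^{t-1}$) and all reconstruction functions $\hat x_t=\hat x_t(w^t,y^t)$, such that for all $t\le T$ the Markov chain $(y^t,x^{t-1})\leftrightarrow(x^t,w^{t-1})\leftrightarrow w_t$ holds and $\frac1T\sum_{t=1}^T\mathbb E[(x_t-\hat x_t)^2]\le D$. Theorem. $R^{\mathrm{dec}}_{c}(D)\le R^{\mathrm{dec}}_{c,op}(D)$. -/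

import Mathlib

open MeasureTheory ProbabilityTheory Filter
open scoped ENNReal NNReal

noncomputable section

namespace CausalRD

/-! ### Sequences over a finite horizon

A real sequence `a^T = (a_1, …, a_T)` is a function `Fin T → ℝ`; the index `i : Fin T` stands for
time `i + 1`. -/

/-- Real sequences of length `T`. -/
abbrev Seq (T : ℕ) : Type := Fin T → ℝ

/-- Values of a real sequence up to and including time `t`, i.e. the range of `a ↦ a^t`. -/
abbrev Past {T : ℕ} (t : Fin T) : Type := Set.Iic t → ℝ

/-- Values of a real sequence strictly before time `t`, i.e. the range of `a ↦ a^{t-1}`. -/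
abbrev StrictPast {T : ℕ} (t : Fin T) : Type := Set.Iio t → ℝ

/-- The prefix `a^t`. -/
def upTo {T : ℕ} (t : Fin T) (a : Seq T) : Past t := fun s => a s

/-- The prefix `a^{t-1}` (empty at the initial time). -/
def before {T : ℕ} (t : Fin T) (a : Seq T) : StrictPast t := fun s => a s

@[fun_prop]
theorem measurable_upTo {T : ℕ} (t : Fin T) : Measurable (upTo t) :=
  measurable_pi_lambda _ fun _ => measurable_pi_apply _

@[fun_prop]
theorem measurable_before {T : ℕ} (t : Fin T) : Measurable (before t) :=
  measurable_pi_lambda _ fun _ => measurable_pi_apply _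

/-! ### The Gauss–Markov source and the side information -/

/-- The state sequence `x_0 = 0`, `x_{t+1} = lam * x_t + v_{t+1}`; the disturbance `v_{t+1}` is
stored at index `t`. -/
def state (lam : ℝ) (v : ℕ → ℝ) : ℕ → ℝ
  | 0 => 0
  | t + 1 => lam * state lam v t + v t

/-- The source samples `x_1, …, x_T`. -/
def sourceSeq (lam : ℝ) (T : ℕ) (v : ℕ → ℝ) : Seq T := fun t => state lam v (t + 1)

/-- The side information `y_t = x_t + n_t` at times `1, …, T`; `n_{t+1}` is stored at index `t`. -/
def sideInfoSeq (lam : ℝ) (T : ℕ) (v n : ℕ → ℝ) : Seq T := fun t => sourceSeq lam T v t + n t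

/-- Joint law of the disturbances and of the side-information noises: two independent sequences of
i.i.d. centred Gaussians, of variances `varV` and `varN`. -/
def noiseLaw (varV varN : ℝ≥0) : Measure ((ℕ → ℝ) × (ℕ → ℝ)) :=
  (Measure.infinitePi fun _ : ℕ => gaussianReal 0 varV).prod
    (Measure.infinitePi fun _ : ℕ => gaussianReal 0 varN)

/-- Joint law of `(x^T, y^T)`. -/
def sourceLaw (lam : ℝ) (varV varN : ℝ≥0) (T : ℕ) : Measure (Seq T × Seq T) :=
  (noiseLaw varV varN).map fun e => (sourceSeq lam T e.1, sideInfoSeq lam T e.1 e.2)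

theorem measurable_state (lam : ℝ) (t : ℕ) : Measurable fun v : ℕ → ℝ => state lam v t := by
  induction t with
  | zero => exact measurable_const
  | succ t ih => exact (ih.const_mul lam).add (measurable_pi_apply t)

theorem measurable_source (lam : ℝ) (T : ℕ) : Measurable fun e : (ℕ → ℝ) × (ℕ → ℝ) =>
    (sourceSeq lam T e.1, sideInfoSeq lam T e.1 e.2) := by
  have h (t : Fin T) := (measurable_state lam (t + 1)).comp
    (measurable_fst : Measurable fun e : (ℕ → ℝ) × (ℕ → ℝ) => e.1)
  refine (measurable_pi_lambda _ h).prodMk (measurable_pi_lambda _ fun t => ?_)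
  exact (h t).add ((measurable_pi_apply _).comp measurable_snd)

instance (varV varN : ℝ≥0) : IsProbabilityMeasure (noiseLaw varV varN) := by
  unfold noiseLaw
  infer_instance

instance (lam : ℝ) (varV varN : ℝ≥0) (T : ℕ) :
    IsProbabilityMeasure (sourceLaw lam varV varN T) :=
  Measure.isProbabilityMeasure_map (measurable_source lam T).aemeasurable

/-! ### Conditional mutual information and directed information -/

/-- Conditional mutual information `I(X; Y | Z)` in bits: the divergence of the law of `(Z, X, Y)`
from the law under which `X` and `Y` keep their conditional laws given `Z` but are conditionally
independent given `Z`. -/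
def condMutualInfo {Ω 𝓧 𝓨 𝓩 : Type*} [MeasurableSpace Ω]
    [MeasurableSpace 𝓧] [StandardBorelSpace 𝓧] [Nonempty 𝓧]
    [MeasurableSpace 𝓨] [StandardBorelSpace 𝓨] [Nonempty 𝓨] [MeasurableSpace 𝓩]
    (μ : Measure Ω) [IsFiniteMeasure μ] (X : Ω → 𝓧) (Y : Ω → 𝓨) (Z : Ω → 𝓩) : ℝ≥0∞ :=
  InformationTheory.klDiv (μ.map fun ω => (Z ω, X ω, Y ω))
      (μ.map Z ⊗ₘ (condDistrib X Z μ ×ₖ condDistrib Y Z μ)) /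
    ENNReal.ofReal (Real.log 2)

/-- Directed information `I(x^T → w^T) = ∑_t I(x^t; w_t | w^{t-1})`, in bits. -/
def directedInfo {Ω : Type*} [MeasurableSpace Ω] {T : ℕ} (μ : Measure Ω) [IsFiniteMeasure μ]
    (x w : Ω → Seq T) : ℝ≥0∞ :=
  ∑ t : Fin T, condMutualInfo μ (fun ω => upTo t (x ω)) (fun ω => w ω t) (fun ω => before t (w ω))

/-- Average-stage quadratic distortion `(1/T) ∑_t E[(x_t - x̂_t)^2]`. -/
def avgDistortion {Ω : Type*} [MeasurableSpace Ω] {T : ℕ} (μ : Measure Ω)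
    (x xhat : Ω → Seq T) : ℝ≥0∞ :=
  (∑ t : Fin T, ∫⁻ ω, ENNReal.ofReal ((x ω t - xhat ω t) ^ 2) ∂μ) / (T : ℝ≥0∞)

/-! ### Information causal rate–distortion function with decoder side information -/

/-- Triples `(x^T, y^T, w^T)`. -/
abbrev Triple (T : ℕ) : Type := Seq T × Seq T × Seq T

/-- The pair `(x^t, w^{t-1})`. -/
def causalCond {T : ℕ} (t : Fin T) (p : Triple T) : Past t × StrictPast t :=
  (upTo t p.1, before t p.2.2)

@[fun_prop]
theorem measurable_causalCond {T : ℕ} (t : Fin T) : Measurable (causalCond t) := by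
  unfold causalCond
  fun_prop

/-- `μ` is a joint law of `(x^T, y^T, w^T)` obtained by feeding the source into a causal kernel
`P(w^T ‖ x^T) = ∏_t P(w_t | w^{t-1}, x^t)`. -/
structure IsCausalTestChannel (lam : ℝ) (varV varN : ℝ≥0) (T : ℕ) (μ : Measure (Triple T)) :
    Prop where
  /-- `(x^T, y^T)` has the law of the source and its side information. -/
  source : μ.map (fun p => (p.1, p.2.1)) = sourceLaw lam varV varN T
  /-- `w_t` is drawn, given all of `x^T, y^T, w^{t-1}`, from a kernel `P(w_t | w^{t-1}, x^t)`. -/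
  causal : ∀ t : Fin T, ∃ κ : Kernel (Past t × StrictPast t) ℝ, IsMarkovKernel κ ∧
    HasCondDistrib (fun p : Triple T => p.2.2 t)
      (fun p : Triple T => (p.1, p.2.1, before t p.2.2))
      (κ.comap (fun q : Seq T × Seq T × StrictPast t => (upTo t q.1, q.2.2)) (by fun_prop)) μ

/-- The Markov chains `(y^t, x^{t-1}) → (x^t, w^{t-1}) → w_t`. -/
def MarkovConstraint {T : ℕ} (μ : Measure (Triple T)) [IsFiniteMeasure μ] : Prop :=
  ∀ t : Fin T,
    CondIndepFun (MeasurableSpace.comap (causalCond t) inferInstance)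
      (measurable_causalCond t).comap_le
      (fun p : Triple T => (upTo t p.2.1, before t p.1)) (fun p : Triple T => p.2.2 t) μ

/-- A causal reconstruction rule `x̂_t = x̂_t(w^t, y^t)`. -/
structure Reconstruction (T : ℕ) where
  /-- The function `x̂_t`. -/
  fn : ∀ t : Fin T, Past t → Past t → ℝ
  measurable_fn : ∀ t, Measurable fun q : Past t × Past t => fn t q.1 q.2

/-- The reconstructed sequence `x̂^T`. -/
def Reconstruction.output {T : ℕ} (g : Reconstruction T) (w y : Seq T) : Seq T :=
  fun t => g.fn t (upTo t w) (upTo t y)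

/-- For horizon `T`: the infimum of `(1/T) I(x^T → w^T)` over causal kernels `P(w^T ‖ x^T)` and
reconstruction rules satisfying the Markov and the distortion constraints. -/
def infoRDHorizon (lam : ℝ) (varV varN : ℝ≥0) (D : ℝ≥0) (T : ℕ) : ℝ≥0∞ :=
  ⨅ (μ : ProbabilityMeasure (Triple T)) (g : Reconstruction T)
    (_ : IsCausalTestChannel lam varV varN T (μ : Measure (Triple T)))
    (_ : MarkovConstraint (μ : Measure (Triple T)))
    (_ : avgDistortion (μ : Measure (Triple T)) (fun p => p.1) (fun p => g.output p.2.2 p.2.1) ≤ D),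
    directedInfo (μ : Measure (Triple T)) (fun p => p.1) (fun p => p.2.2) / (T : ℝ≥0∞)

/-- The information causal rate–distortion function with decoder side information. -/
def infoRD (lam : ℝ) (varV varN : ℝ≥0) (D : ℝ≥0) : ℝ≥0∞ :=
  limsup (fun T : ℕ => infoRDHorizon lam varV varN D T) atTop

/-! ### Operational causal rate–distortion function with decoder side information -/

/-- A causal code of horizon `T` with decoder side information. The packet sent at time `t` takes
values in a set of `⌊2 ^ R_t⌋` elements (in particular `R_t ≥ 0`, since that set cannot be
empty). -/
structure Code (T : ℕ) where
  /-- The rates `R_t`. -/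
  rate : Fin T → ℝ
  /-- The encoders, packet `= F_t(x^t)`. -/
  enc : ∀ t : Fin T, Past t → Fin ⌊(2 : ℝ) ^ rate t⌋₊
  /-- The decoders, `x̂_t = G_t(packets up to t, y^t)`. -/
  dec : ∀ t : Fin T, (∀ s : Set.Iic t, Fin ⌊(2 : ℝ) ^ rate s⌋₊) → Past t → ℝ
  measurable_enc : ∀ t, Measurable (enc t)
  measurable_dec : ∀ t, Measurable
    fun q : (∀ s : Set.Iic t, Fin ⌊(2 : ℝ) ^ rate s⌋₊) × Past t => dec t q.1 q.2

namespace Code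

variable {T : ℕ}

/-- The average rate `(1/T) ∑_t R_t`. -/
def avgRate (c : Code T) : ℝ := (∑ t : Fin T, c.rate t) / T

/-- The sequence of estimates produced by the code from `x^T` and `y^T`. -/
def output (c : Code T) (x y : Seq T) : Seq T :=
  fun t => c.dec t (fun s => c.enc s (upTo (s : Fin T) x)) (upTo t y)

/-- The average-stage distortion of the code. -/
def distortion (c : Code T) (lam : ℝ) (varV varN : ℝ≥0) : ℝ≥0∞ :=
  avgDistortion (sourceLaw lam varV varN T) (fun p => p.1) (fun p => c.output p.1 p.2)

end Code

/-- The rate `R` is achievable at distortion `D`: for every sufficiently large horizon there is a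
causal code with decoder side information, of average rate at most `R` and average distortion at
most `D`. -/
def Achievable (lam : ℝ) (varV varN : ℝ≥0) (D R : ℝ≥0) : Prop :=
  ∀ᶠ T : ℕ in atTop, ∃ c : Code T, c.avgRate ≤ R ∧ c.distortion lam varV varN ≤ D

/-- The operational causal rate–distortion function with decoder side information: the infimum of
the achievable average rates (`∞` if there are none). -/
def operationalRD (lam : ℝ) (varV varN : ℝ≥0) (D : ℝ≥0) : ℝ≥0∞ :=
  ⨅ (R : ℝ≥0) (_ : Achievable lam varV varN D R), (R : ℝ≥0∞)

end CausalRD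

end

/-!
A code that is good operationally is itself a test channel: let the auxiliary variable `w_t` be the
packet `F_t(x^t)` read as a real number. It is a deterministic function of `x^t`, so the channel is
causal and the Markov constraints hold; the decoders of the code, applied to the packets recovered
from `w^t`, reconstruct with the same distortion. It remains to see that the information per stage
is at most the rate.

This is `condMutualInfo_le_logb_card`: if `Y = h(X)` takes at most `N` values, then
`I(X; Y | Z) ≤ log₂ N`. Since `Y` is a function of `X`, the law of `(Z, X, Y)` has the density
`r = 1[y = h(x)] / P(y | z)` with respect to the law `Q` making `X` and `Y` conditionally
independent given `Z` (`map_eq_withDensity_condIndep`). The second moment of `r` under `Q` is the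
mean of `1 / P(Y | Z)`, hence at most `N` (`lintegral_inv_condDistrib_singleton_le`). Integrating
the tangent bound `r log r ≤ r log N + r² / N - r` against `Q` gives a divergence of at most
`log N + 1 - 1`. The bound is used in the form `klFun_add_two_mul_le`, where both sides are
nonnegative, so that no integrability has to be checked.

With `N = ⌊2 ^ R_t⌋`, each stage carries at most `R_t` bits, so the information function at horizon
`T` is at most the average rate of any code meeting the distortion constraint
(`Code.infoRDHorizon_le_avgRate`).
-/

/-! ### Information carried by a variable with finitely many values -/

namespace CausalRD

open InformationTheory

section InformationBound

variable {Ω 𝓧 𝓨 𝓩 : Type*} [MeasurableSpace Ω]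
  [MeasurableSpace 𝓧] [StandardBorelSpace 𝓧] [Nonempty 𝓧]
  [MeasurableSpace 𝓨] [StandardBorelSpace 𝓨] [Nonempty 𝓨] [MeasurableSpace 𝓩]
  {μ : Measure Ω} [IsProbabilityMeasure μ] {X : Ω → 𝓧} {Y : Ω → 𝓨} {Z : Ω → 𝓩}

theorem setLIntegral_preimage_singleton (hY : Measurable Y) (hZ : Measurable Z)
    {k : 𝓩 → ℝ≥0∞} (hk : Measurable k) (y : 𝓨) :
    ∫⁻ ω in Y ⁻¹' {y}, k (Z ω) ∂μ = ∫⁻ z, k z * condDistrib Y Z μ z {y} ∂(μ.map Z) := by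
  have hF : Measurable fun q : 𝓩 × 𝓨 => ({y} : Set 𝓨).indicator (fun _ => k q.1) q.2 := by
    have : (fun q : 𝓩 × 𝓨 => ({y} : Set 𝓨).indicator (fun _ => k q.1) q.2)
        = (Prod.snd ⁻¹' {y}).indicator fun q => k q.1 := by
      ext q; by_cases hq : q.2 = y <;> simp [hq]
    rw [this]
    exact (hk.comp measurable_fst).indicator (measurable_snd (measurableSet_singleton y))
  have h := Measure.lintegral_compProd (μ := μ.map Z) (κ := condDistrib Y Z μ) hF
  rw [compProd_map_condDistrib hY.aemeasurable, lintegral_map hF (hZ.prodMk hY)] at h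
  rw [← lintegral_indicator (hY (measurableSet_singleton y))]
  have e : (fun ω => (Y ⁻¹' {y}).indicator (fun ω => k (Z ω)) ω)
      = fun ω => ({y} : Set 𝓨).indicator (fun _ => k (Z ω)) (Y ω) := by
    ext ω; by_cases hω : Y ω = y <;> simp [hω]
  rw [e, h]
  refine lintegral_congr fun z => ?_
  simp [lintegral_indicator (measurableSet_singleton y)]

theorem measurable_condDistrib_singleton :
    Measurable fun q : 𝓩 × 𝓨 => condDistrib Y Z μ q.1 {q.2} := by
  have h := Kernel.measurable_kernel_prodMk_left
    (κ := (condDistrib Y Z μ).comap (Prod.fst : 𝓩 × 𝓨 → 𝓩) measurable_fst)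
    (t := {q : (𝓩 × 𝓨) × 𝓨 | q.2 = q.1.2})
    (measurableSet_eq_fun measurable_snd (measurable_snd.comp measurable_fst))
  exact h

/-- Almost surely, the observed value of a variable with finitely many values has positive
conditional probability. -/
theorem ae_condDistrib_singleton_ne_zero (hY : Measurable Y) (hZ : Measurable Z) {S : Finset 𝓨}
    (hS : ∀ᵐ ω ∂μ, Y ω ∈ S) : ∀ᵐ ω ∂μ, condDistrib Y Z μ (Z ω) {Y ω} ≠ 0 := by
  have key (y : 𝓨) : ∀ᵐ ω ∂μ, Y ω = y → condDistrib Y Z μ (Z ω) {y} ≠ 0 := by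
    have hA : MeasurableSet {z | condDistrib Y Z μ z {y} = 0} :=
      (condDistrib Y Z μ).measurable_coe (measurableSet_singleton y) (measurableSet_singleton 0)
    have h := setLIntegral_preimage_singleton (μ := μ) hY hZ
      (measurable_const.indicator hA : Measurable (Set.indicator _ fun _ => (1 : ℝ≥0∞))) y
    have h0 : (fun z => {z | condDistrib Y Z μ z {y} = 0}.indicator (fun _ => (1 : ℝ≥0∞)) z
        * condDistrib Y Z μ z {y}) = 0 := by
      ext z
      by_cases hz : condDistrib Y Z μ z {y} = 0 <;> simp [hz]
    have hI : Measurable fun ω =>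
        {z | condDistrib Y Z μ z {y} = 0}.indicator (fun _ => (1 : ℝ≥0∞)) (Z ω) :=
      (measurable_const.indicator hA).comp hZ
    rw [h0, Pi.zero_def, lintegral_zero, lintegral_eq_zero_iff hI] at h
    filter_upwards [(ae_restrict_iff' (hY (measurableSet_singleton y))).1 h] with ω hω hy hz
    have := hω hy
    simp [hz] at this
  filter_upwards [hS, (ae_ball_iff S.countable_toSet).2 fun y _ => key y] with ω h1 h2
  exact h2 _ h1 rfl

/-- The inverse conditional probability of the observed value averages to at most the number of
values. -/
theorem lintegral_inv_condDistrib_singleton_le (hY : Measurable Y) (hZ : Measurable Z)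
    {S : Finset 𝓨} (hS : ∀ᵐ ω ∂μ, Y ω ∈ S) :
    ∫⁻ ω, (condDistrib Y Z μ (Z ω) {Y ω})⁻¹ ∂μ ≤ S.card := by
  classical
  calc ∫⁻ ω, (condDistrib Y Z μ (Z ω) {Y ω})⁻¹ ∂μ
      = ∫⁻ ω in ⋃ y ∈ S, Y ⁻¹' {y}, (condDistrib Y Z μ (Z ω) {Y ω})⁻¹ ∂μ := by
        rw [Measure.restrict_eq_self_of_ae_mem]
        filter_upwards [hS] with ω h
        simpa using h
    _ = ∑ y ∈ S, ∫⁻ ω in Y ⁻¹' {y}, (condDistrib Y Z μ (Z ω) {Y ω})⁻¹ ∂μ := by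
        refine lintegral_biUnion_finset (fun y _ y' _ hyy => ?_)
          (fun y _ => hY (measurableSet_singleton y)) _
        exact Disjoint.preimage Y (by simpa using hyy)
    _ = ∑ y ∈ S, ∫⁻ z, (condDistrib Y Z μ z {y})⁻¹ * condDistrib Y Z μ z {y} ∂(μ.map Z) := by
        refine Finset.sum_congr rfl fun y _ => ?_
        rw [← setLIntegral_preimage_singleton (μ := μ)
          (k := fun z => (condDistrib Y Z μ z {y})⁻¹) hY hZ
          ((condDistrib Y Z μ).measurable_coe (measurableSet_singleton y)).inv y]
        refine setLIntegral_congr_fun (hY (measurableSet_singleton y)) fun ω hω => ?_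
        have : Y ω = y := hω
        simp [this]
    _ ≤ ∑ y ∈ S, ∫⁻ _, 1 ∂(μ.map Z) := by
        gcongr with y _ z
        exact ENNReal.inv_mul_le_one _
    _ = S.card := by
        have := Measure.isProbabilityMeasure_map (μ := μ) hZ.aemeasurable
        simp

/-- If `Y = h(X)` takes finitely many values, the law of `(Z, X, Y)` has the explicit density
`1[y = h(x)] / P(y | z)` with respect to the law that makes `X` and `Y` conditionally independent
given `Z`. -/
theorem map_eq_withDensity_condIndep (hX : Measurable X) (hY : Measurable Y) (hZ : Measurable Z)
    {S : Finset 𝓨} (hS : ∀ᵐ ω ∂μ, Y ω ∈ S) {h : 𝓧 → 𝓨} (hh : Measurable h)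
    (hYX : ∀ᵐ ω ∂μ, Y ω = h (X ω)) :
    μ.map (fun ω => (Z ω, X ω, Y ω)) =
      (μ.map Z ⊗ₘ (condDistrib X Z μ ×ₖ condDistrib Y Z μ)).withDensity
        ({q : 𝓩 × 𝓧 × 𝓨 | q.2.2 = h q.2.1}.indicator
          fun q => (condDistrib Y Z μ q.1 {q.2.2})⁻¹) := by
  have hE : MeasurableSet {q : 𝓩 × 𝓧 × 𝓨 | q.2.2 = h q.2.1} :=
    measurableSet_eq_fun (by fun_prop) (by fun_prop)
  have hg : Measurable fun q : 𝓩 × 𝓧 × 𝓨 => (condDistrib Y Z μ q.1 {q.2.2})⁻¹ :=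
    ((measurable_condDistrib_singleton (μ := μ) (Y := Y) (Z := Z)).comp
      (measurable_fst.prodMk (measurable_snd.comp measurable_snd))).inv
  have hf := hg.indicator hE
  ext A hA
  rw [withDensity_apply _ hA, ← lintegral_indicator hA,
    Measure.lintegral_compProd (hf.indicator hA)]
  -- The inner integrals: integrating out `y` leaves the mass of the point `h x`, which cancels.
  have hG : Measurable fun q : 𝓩 × 𝓧 =>
      {q : 𝓩 × 𝓧 | (q.1, q.2, h q.2) ∈ A}.indicator
        (fun q => (condDistrib Y Z μ q.1 {h q.2})⁻¹ * condDistrib Y Z μ q.1 {h q.2}) q := by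
    have hp := (measurable_condDistrib_singleton (μ := μ) (Y := Y) (Z := Z)).comp
      (measurable_fst.prodMk (hh.comp measurable_snd) : Measurable fun q : 𝓩 × 𝓧 => (q.1, h q.2))
    refine (hp.inv.mul hp).indicator ?_
    exact (measurable_fst.prodMk (measurable_snd.prodMk (hh.comp measurable_snd)) :
      Measurable fun q : 𝓩 × 𝓧 => (q.1, q.2, h q.2)) hA
  have inner (z : 𝓩) : ∫⁻ b, A.indicator ({q : 𝓩 × 𝓧 × 𝓨 | q.2.2 = h q.2.1}.indicator
        fun q => (condDistrib Y Z μ q.1 {q.2.2})⁻¹) (z, b)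
          ∂((condDistrib X Z μ ×ₖ condDistrib Y Z μ) z)
      = ∫⁻ x, {q : 𝓩 × 𝓧 | (q.1, q.2, h q.2) ∈ A}.indicator
        (fun q => (condDistrib Y Z μ q.1 {h q.2})⁻¹ * condDistrib Y Z μ q.1 {h q.2}) (z, x)
          ∂(condDistrib X Z μ z) := by
    rw [Kernel.prod_apply]
    refine (lintegral_prod _ ((hf.indicator hA).comp
      (measurable_prodMk_left (x := z))).aemeasurable).trans ?_
    simp only [Function.comp_apply]
    refine lintegral_congr fun x => ?_
    have e : (fun y => A.indicator ({q : 𝓩 × 𝓧 × 𝓨 | q.2.2 = h q.2.1}.indicator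
          fun q => (condDistrib Y Z μ q.1 {q.2.2})⁻¹) (z, x, y))
        = ({h x} : Set 𝓨).indicator fun _ => {q : 𝓩 × 𝓧 | (q.1, q.2, h q.2) ∈ A}.indicator
          (fun q => (condDistrib Y Z μ q.1 {h q.2})⁻¹) (z, x) := by
      ext y
      by_cases hy : y = h x
      · subst hy; simp [Set.indicator]
      · simp [Set.indicator, hy]
    rw [e, lintegral_indicator (measurableSet_singleton _), setLIntegral_const]
    by_cases hxA : (z, x, h x) ∈ A <;> simp [Set.indicator, hxA]
  simp_rw [inner]
  rw [← Measure.lintegral_compProd hG, compProd_map_condDistrib hX.aemeasurable,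
    lintegral_map hG (hZ.prodMk hX), Measure.map_apply (by fun_prop) hA,
    ← lintegral_indicator_one ((hZ.prodMk (hX.prodMk hY)) hA)]
  refine lintegral_congr_ae ?_
  filter_upwards [hYX, ae_condDistrib_singleton_ne_zero hY hZ hS] with ω h1 h2
  rw [h1] at h2
  by_cases hA' : (Z ω, X ω, h (X ω)) ∈ A <;>
    simp [Set.indicator, h1, hA', ENNReal.inv_mul_cancel h2 (measure_ne_top _ _)]

/-- The tangent bound `log (r / N) ≤ r / N - 1`, multiplied by `r` and arranged so that both sides
are nonnegative. -/
theorem klFun_add_two_mul_le {N : ℕ} (hN : N ≠ 0) {r : ℝ≥0∞} (hr : r ≠ ∞) :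
    ENNReal.ofReal (klFun r.toReal) + 2 * r
      ≤ ENNReal.ofReal (Real.log N) * r + (N : ℝ≥0∞)⁻¹ * (r * r) + 1 := by
  lift r to ℝ≥0 using hr
  have hN0 : (0 : ℝ) < N := by positivity
  have hlog : 0 ≤ Real.log N := Real.log_natCast_nonneg N
  have hr0 : (0 : ℝ) ≤ r := r.2
  have e1 : ((r : ℝ≥0∞)) = ENNReal.ofReal (r : ℝ) := (ENNReal.ofReal_coe_nnreal).symm
  have e2 : (N : ℝ≥0∞)⁻¹ = ENNReal.ofReal ((N : ℝ)⁻¹) := by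
    rw [ENNReal.ofReal_inv_of_pos hN0, ENNReal.ofReal_natCast]
  have e3 : (2 : ℝ≥0∞) = ENNReal.ofReal 2 := by simp
  rw [ENNReal.coe_toReal, e1, e2, e3, ← ENNReal.ofReal_one, ← ENNReal.ofReal_mul (by norm_num),
    ← ENNReal.ofReal_mul hlog, ← ENNReal.ofReal_mul hr0, ← ENNReal.ofReal_mul (by positivity),
    ← ENNReal.ofReal_add (klFun_nonneg hr0) (by positivity),
    ← ENNReal.ofReal_add (by positivity) (by positivity),
    ← ENNReal.ofReal_add (by positivity) (by positivity)]
  refine ENNReal.ofReal_le_ofReal ?_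
  rw [klFun_apply]
  rcases hr0.eq_or_lt with h0 | h0
  · rw [← h0]; simp
  · have h1 := Real.log_le_sub_one_of_pos (div_pos h0 hN0)
    rw [Real.log_div h0.ne' hN0.ne'] at h1
    have h2 := mul_le_mul_of_nonneg_left h1 hr0
    have h3 : (r : ℝ) * (r / N - 1) = (N : ℝ)⁻¹ * (r * r) - r := by field_simp
    rw [h3] at h2
    linarith

/-- A function of `X` with finitely many values carries at most the logarithm of their number as
information about `X`, whatever the conditioning. -/
theorem condMutualInfo_le_logb_card (hX : Measurable X) (hY : Measurable Y) (hZ : Measurable Z)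
    {S : Finset 𝓨} (hS : ∀ᵐ ω ∂μ, Y ω ∈ S) {h : 𝓧 → 𝓨} (hh : Measurable h)
    (hYX : ∀ᵐ ω ∂μ, Y ω = h (X ω)) :
    condMutualInfo μ X Y Z ≤ ENNReal.ofReal (Real.logb 2 S.card) := by
  have hN : S.card ≠ 0 := by
    obtain ⟨ω, hω⟩ := hS.exists
    exact (Finset.card_pos.2 ⟨_, hω⟩).ne'
  rw [condMutualInfo, Real.logb, ENNReal.ofReal_div_of_pos (Real.log_pos (by norm_num))]
  gcongr
  have := Measure.isProbabilityMeasure_map (μ := μ) hZ.aemeasurable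
  have hm : Measurable fun ω => (Z ω, X ω, Y ω) := hZ.prodMk (hX.prodMk hY)
  have := Measure.isProbabilityMeasure_map (μ := μ) hm.aemeasurable
  set J := μ.map fun ω => (Z ω, X ω, Y ω) with hJ
  set Q := μ.map Z ⊗ₘ (condDistrib X Z μ ×ₖ condDistrib Y Z μ) with hQ
  have hg : Measurable fun q : 𝓩 × 𝓧 × 𝓨 => (condDistrib Y Z μ q.1 {q.2.2})⁻¹ :=
    ((measurable_condDistrib_singleton (μ := μ) (Y := Y) (Z := Z)).comp
      (measurable_fst.prodMk (measurable_snd.comp measurable_snd))).inv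
  have hE : MeasurableSet {q : 𝓩 × 𝓧 × 𝓨 | q.2.2 = h q.2.1} :=
    measurableSet_eq_fun (by fun_prop) (by fun_prop)
  have hd := map_eq_withDensity_condIndep hX hY hZ hS hh hYX
  rw [← hJ, ← hQ] at hd
  have hac : J ≪ Q := hd ▸ withDensity_absolutelyContinuous _ _
  have hr := Q.rnDeriv_withDensity (hg.indicator hE)
  rw [← hd] at hr
  have hrm : Measurable (J.rnDeriv Q) := Measure.measurable_rnDeriv _ _
  have h1 : ∫⁻ q, J.rnDeriv Q q ∂Q = 1 := by
    rw [Measure.lintegral_rnDeriv hac, measure_univ]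
  -- The second moment of the density is the mean of the density under the joint law.
  have h2 : ∫⁻ q, J.rnDeriv Q q * J.rnDeriv Q q ∂Q ≤ S.card := by
    rw [lintegral_rnDeriv_mul hac hrm.aemeasurable]
    calc ∫⁻ q, J.rnDeriv Q q ∂J ≤ ∫⁻ q, (condDistrib Y Z μ q.1 {q.2.2})⁻¹ ∂J := by
          refine lintegral_mono_ae (hac.ae_le ?_)
          filter_upwards [hr] with q hq
          rw [hq]
          exact Set.indicator_le_self' (fun _ _ => zero_le) q
      _ = ∫⁻ ω, (condDistrib Y Z μ (Z ω) {Y ω})⁻¹ ∂μ := lintegral_map hg hm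
      _ ≤ S.card := lintegral_inv_condDistrib_singleton_le hY hZ hS
  rw [klDiv_eq_lintegral_klFun_of_ac hac]
  refine (ENNReal.add_le_add_iff_right (by simp : (2 : ℝ≥0∞) ≠ ∞)).1 ?_
  calc ∫⁻ q, ENNReal.ofReal (klFun (J.rnDeriv Q q).toReal) ∂Q + 2
      = ∫⁻ q, (ENNReal.ofReal (klFun (J.rnDeriv Q q).toReal) + 2 * J.rnDeriv Q q) ∂Q := by
        rw [lintegral_add_right _ (hrm.const_mul 2), lintegral_const_mul _ hrm, h1, mul_one]
    _ ≤ ∫⁻ q, (ENNReal.ofReal (Real.log S.card) * J.rnDeriv Q q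
          + (S.card : ℝ≥0∞)⁻¹ * (J.rnDeriv Q q * J.rnDeriv Q q) + 1) ∂Q := by
        refine lintegral_mono_ae ?_
        filter_upwards [J.rnDeriv_lt_top Q] with q hq
        exact klFun_add_two_mul_le hN hq.ne
    _ = ENNReal.ofReal (Real.log S.card)
          + (S.card : ℝ≥0∞)⁻¹ * ∫⁻ q, J.rnDeriv Q q * J.rnDeriv Q q ∂Q + 1 := by
        have hrr : Measurable fun q => J.rnDeriv Q q * J.rnDeriv Q q := hrm.mul hrm
        rw [lintegral_add_right _ measurable_const, lintegral_add_right _ (hrr.const_mul _),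
          lintegral_const_mul _ hrm, lintegral_const_mul _ hrr, h1]
        simp
    _ ≤ ENNReal.ofReal (Real.log S.card) + 1 + 1 := by
        gcongr
        exact (mul_le_mul_right h2 _).trans (ENNReal.inv_mul_le_one _)
    _ = ENNReal.ofReal (Real.log S.card) + 2 := by rw [add_assoc, one_add_one_eq_two]

end InformationBound

/-! ### Variables that are almost surely functions of the conditioning -/

/-- Conditional independence of `f` and `g` given `m'` holds as soon as `g` is almost surely equal
to an `m'`-measurable function. -/
theorem condIndepFun_of_ae_eq_measurable_right {Ω β γ : Type*} {m' mΩ : MeasurableSpace Ω}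
    [StandardBorelSpace Ω] [MeasurableSpace β] [MeasurableSpace γ] {hm' : m' ≤ mΩ}
    {μ : Measure Ω} [IsFiniteMeasure μ] {f : Ω → β} {g g' : Ω → γ} (hf : Measurable f)
    (hg' : Measurable[m'] g') (h : g =ᵐ[μ] g') : CondIndepFun m' hm' f g μ := by
  have h' : g' =ᵐ[condExpKernel μ m' ∘ₘ μ.trim hm'] g := by
    rw [condExpKernel_comp_trim hm']
    exact h.symm
  exact Kernel.IndepFun.congr' (condIndepFun_of_measurable_right (hm' := hm') (μ := μ) hf hg')
    (Eventually.of_forall fun _ => .rfl) (Measure.ae_ae_of_ae_comp h')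

theorem hasCondDistrib_deterministic {Ω 𝓧 𝓨 : Type*} [MeasurableSpace Ω] [MeasurableSpace 𝓧]
    [MeasurableSpace 𝓨] {μ : Measure Ω} [IsFiniteMeasure μ] {X : Ω → 𝓧} {Y : Ω → 𝓨} {f : 𝓧 → 𝓨}
    (hX : Measurable X) (hY : Measurable Y) (hf : Measurable f) (h : ∀ᵐ ω ∂μ, Y ω = f (X ω)) :
    HasCondDistrib Y X (Kernel.deterministic f hf) μ where
  aemeasurable := (hX.prodMk hY).aemeasurable
  map_eq := by
    rw [Measure.compProd_deterministic, Measure.map_map (by fun_prop) hX]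
    refine Measure.map_congr ?_
    filter_upwards [h] with ω hω
    simp [hω]

/-! ### The test channel of a code -/

namespace Code

variable {T : ℕ} (c : Code T)

/-- The packet sent at time `t`, read as a real number. -/
noncomputable def packet (t : Fin T) (a : Past t) : ℝ := ((c.enc t a : ℕ) : ℝ)

@[fun_prop]
theorem measurable_packet (t : Fin T) : Measurable (c.packet t) := by
  have h : Measurable fun i : Fin ⌊(2 : ℝ) ^ c.rate t⌋₊ => ((i : ℕ) : ℝ) :=
    measurable_of_finite _
  exact h.comp (c.measurable_enc t)

/-- The packet encoded by a real number; reals whose floor is not a packet index are sent to an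
arbitrary packet. -/
noncomputable def unpack (t : Fin T) (r : ℝ) : Fin ⌊(2 : ℝ) ^ c.rate t⌋₊ :=
  if h : ⌊r⌋₊ < ⌊(2 : ℝ) ^ c.rate t⌋₊ then ⟨⌊r⌋₊, h⟩ else c.enc t 0

@[fun_prop]
theorem measurable_unpack (t : Fin T) : Measurable (c.unpack t) := by
  have h : Measurable fun k : ℕ => if h : k < ⌊(2 : ℝ) ^ c.rate t⌋₊ then
      (⟨k, h⟩ : Fin ⌊(2 : ℝ) ^ c.rate t⌋₊) else c.enc t 0 := measurable_from_top
  exact h.comp Nat.measurable_floor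

theorem unpack_packet (t : Fin T) (a : Past t) : c.unpack t (c.packet t a) = c.enc t a := by
  simp [unpack, packet]

theorem rate_nonneg (t : Fin T) : 0 ≤ c.rate t := by
  by_contra! h
  have h0 : ⌊(2 : ℝ) ^ c.rate t⌋₊ = 0 :=
    Nat.floor_eq_zero.2 (Real.rpow_lt_one_of_one_lt_of_neg one_lt_two h)
  exact absurd (c.enc t 0).2 (by omega)

/-- The joint law of `(x^T, y^T, w^T)` when `w_t` is the packet that the code sends at time `t`. -/
noncomputable def channelLaw (lam : ℝ) (varV varN : ℝ≥0) : Measure (Triple T) :=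
  (sourceLaw lam varV varN T).map
    fun p => (p.1, p.2, fun t => c.packet t (upTo t p.1))

theorem measurable_channel : Measurable fun p : Seq T × Seq T =>
    ((p.1, p.2, fun t => c.packet t (upTo t p.1)) : Triple T) := by
  refine measurable_fst.prodMk (measurable_snd.prodMk (measurable_pi_lambda _ fun t => ?_))
  fun_prop

instance (lam : ℝ) (varV varN : ℝ≥0) : IsProbabilityMeasure (c.channelLaw lam varV varN) :=
  Measure.isProbabilityMeasure_map c.measurable_channel.aemeasurable

theorem ae_channelLaw (lam : ℝ) (varV varN : ℝ≥0) (t : Fin T) :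
    ∀ᵐ p ∂c.channelLaw lam varV varN, p.2.2 t = c.packet t (upTo t p.1) := by
  rw [channelLaw, ae_map_iff c.measurable_channel.aemeasurable
    (measurableSet_eq_fun (by fun_prop) (by fun_prop))]
  exact Eventually.of_forall fun _ => rfl

theorem isCausalTestChannel (lam : ℝ) (varV varN : ℝ≥0) :
    IsCausalTestChannel lam varV varN T (c.channelLaw lam varV varN) where
  source := by
    rw [channelLaw, Measure.map_map (by fun_prop) c.measurable_channel]
    exact Measure.map_id
  causal t := by
    refine ⟨Kernel.deterministic (fun q => c.packet t q.1) (by fun_prop), inferInstance, ?_⟩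
    exact hasCondDistrib_deterministic (f := fun q : Seq T × Seq T × StrictPast t =>
      c.packet t (upTo t q.1)) (by fun_prop) (by fun_prop) (by fun_prop)
      (c.ae_channelLaw lam varV varN t)

theorem markovConstraint (lam : ℝ) (varV varN : ℝ≥0) :
    MarkovConstraint (c.channelLaw lam varV varN) := fun t => by
  refine condIndepFun_of_ae_eq_measurable_right (by fun_prop) ?_ (c.ae_channelLaw lam varV varN t)
  exact ((c.measurable_packet t).comp measurable_fst).comp (comap_measurable (causalCond t))

/-- The decoders of the code, fed with packets read as real numbers. -/
noncomputable def reconstruction : Reconstruction T where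
  fn t w y := c.dec t (fun s => c.unpack s (w s)) y
  measurable_fn t := by
    refine (c.measurable_dec t).comp (.prodMk (measurable_pi_lambda _ fun s => ?_) measurable_snd)
    exact (c.measurable_unpack s).comp ((measurable_pi_apply s).comp measurable_fst)

theorem measurable_reconstruction_output : Measurable fun p : Triple T =>
    c.reconstruction.output p.2.2 p.2.1 :=
  measurable_pi_lambda _ fun t => (c.reconstruction.measurable_fn t).comp
    (f := fun p : Triple T => (upTo t p.2.2, upTo t p.2.1)) (by fun_prop)

theorem avgDistortion_channelLaw (lam : ℝ) (varV varN : ℝ≥0) :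
    avgDistortion (c.channelLaw lam varV varN) (fun p => p.1)
      (fun p => c.reconstruction.output p.2.2 p.2.1) = c.distortion lam varV varN := by
  have hm := c.measurable_reconstruction_output
  unfold avgDistortion distortion avgDistortion channelLaw
  congr 1
  refine Finset.sum_congr rfl fun t _ => ?_
  rw [lintegral_map (by fun_prop) c.measurable_channel]
  refine lintegral_congr fun p => ?_
  have : c.reconstruction.output (fun t => c.packet t (upTo t p.1)) p.2 t = c.output p.1 p.2 t := by
    simp only [Reconstruction.output, reconstruction, output, upTo]
    congr 1
    ext s : 1
    exact c.unpack_packet s _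
  simp only [this]

/-- Each packet carries at most its rate as information, being one of at most `2 ^ R_t` values. -/
theorem condMutualInfo_channelLaw_le (lam : ℝ) (varV varN : ℝ≥0) (t : Fin T) :
    condMutualInfo (c.channelLaw lam varV varN) (fun p => upTo t p.1) (fun p => p.2.2 t)
      (fun p => before t p.2.2) ≤ ENNReal.ofReal (c.rate t) := by
  have hpos : 0 < ⌊(2 : ℝ) ^ c.rate t⌋₊ := (Nat.zero_le _).trans_lt (c.enc t 0).2
  refine (condMutualInfo_le_logb_card (S := (Finset.range ⌊(2 : ℝ) ^ c.rate t⌋₊).map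
    Nat.castEmbedding) (by fun_prop) (by fun_prop) (by fun_prop) ?_ (c.measurable_packet t)
    (c.ae_channelLaw lam varV varN t)).trans ?_
  · filter_upwards [c.ae_channelLaw lam varV varN t] with p hp
    rw [hp]
    exact Finset.mem_map_of_mem _ (Finset.mem_range.2 (c.enc t (upTo t p.1)).2)
  · refine ENNReal.ofReal_le_ofReal ?_
    rw [Finset.card_map, Finset.card_range,
      Real.logb_le_iff_le_rpow one_lt_two (by exact_mod_cast hpos)]
    exact Nat.floor_le (by positivity)

theorem directedInfo_channelLaw_div_le (lam : ℝ) (varV varN : ℝ≥0) :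
    directedInfo (c.channelLaw lam varV varN) (fun p => p.1) (fun p => p.2.2) / (T : ℝ≥0∞)
      ≤ ENNReal.ofReal c.avgRate := by
  rcases Nat.eq_zero_or_pos T with rfl | hT
  · simp [directedInfo]
  rw [avgRate, ENNReal.ofReal_div_of_pos (by exact_mod_cast hT), ENNReal.ofReal_natCast,
    ENNReal.ofReal_sum_of_nonneg fun t _ => c.rate_nonneg t]
  exact ENNReal.div_le_div_right
    (Finset.sum_le_sum fun t _ => c.condMutualInfo_channelLaw_le lam varV varN t) _

theorem infoRDHorizon_le_avgRate {lam : ℝ} {varV varN D : ℝ≥0}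
    (hD : c.distortion lam varV varN ≤ D) :
    infoRDHorizon lam varV varN D T ≤ ENNReal.ofReal c.avgRate :=
  iInf_le_of_le ⟨c.channelLaw lam varV varN, inferInstance⟩ <|
    iInf_le_of_le c.reconstruction <| iInf_le_of_le (c.isCausalTestChannel lam varV varN) <|
    iInf_le_of_le (c.markovConstraint lam varV varN) <|
    iInf_le_of_le ((c.avgDistortion_channelLaw lam varV varN).trans_le hD) <|
    c.directedInfo_channelLaw_div_le lam varV varN

end Code

end CausalRD

theorem mainTheorem1 (lam : ℝ) (varV varN : ℝ≥0) (hV : 0 < varV) (D : ℝ≥0) :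
    CausalRD.infoRD lam varV varN D ≤ CausalRD.operationalRD lam varV varN D := by
  refine le_iInf₂ fun R hR => limsup_le_of_le (by isBoundedDefault) ?_
  filter_upwards [hR] with T hT
  obtain ⟨c, hc, hcD⟩ := hT
  calc CausalRD.infoRDHorizon lam varV varN D T ≤ ENNReal.ofReal c.avgRate :=
        c.infoRDHorizon_le_avgRate hcD
    _ ≤ ENNReal.ofReal R := ENNReal.ofReal_le_ofReal hc
    _ = R := ENNReal.ofReal_coe_nnreal
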